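/- **Theorem 1.2.** A gauge function is a continuous, monotone increasing function $g:[0,\infty)\to[0,\infty)$ with $g(0)=0$ and $g(t)>0$ for $t>0$. For $E\subset\mathbb{R}^n$ put $$\mathcal{H}^g(E)=\lim_{\delta\to0}\ \inf\Big\{\sum_i g(\operatorname{diam}E_i)\ :\ E\subset\bigcup_i E_i,\ \operatorname{diam}E_i<\delta\Big\},$$ where the infimum is over countable covers. For a continuous function $f:[0,1]^n\to\mathbb{R}$ and $x\in[0,1]^n$ put $$l_f(x)=\liminf_{r\to0+}\ \frac{\sup\{|f(y)-f(x)|\ :\ y\in[0,1]^n,\ |y-x|\le r\}}{r}\in[0,\infty],$$ where $|\cdot|$ is the Euclidean norm. Then for every integer $n\ge1$ and every gauge function $g$ there exists a continuous function $f:[0,1]^n\to\mathbb{R}$ such that, for Lebesgue-almost every $x\in[0,1]^n$, $f$ fails to be differentiable at $x$, and $l_f(x)<\infty$ at all points $x\in[0,1]^n$ except those of a set $E\subset[0,1]^n$ with $\mathcal{H}^g(E)=0$. -/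

import Mathlib

open MeasureTheory Filter Topology Set
open scoped NNReal ENNReal

noncomputable section

/-- A gauge function `g : [0,∞) → [0,∞)`: continuous, monotone increasing (in the weak sense),
`g 0 = 0`, and `g t > 0` for `t > 0`. -/
structure IsGaugeFunction (g : ℝ≥0 → ℝ≥0) : Prop where
  continuous : Continuous g
  monotone : Monotone g
  map_zero : g 0 = 0
  pos : ∀ t : ℝ≥0, 0 < t → 0 < g t

/-- The Hausdorff measure `ℋ^g`: the limit as `δ → 0` of the infimum of `∑ g (diam Eᵢ)` over the
countable covers by sets `Eᵢ` of diameter at most `δ`. Only sets of small diameter enter the limit,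
so the value given to an infinite diameter plays no role. -/
def gaugeHausdorffMeasure {X : Type*} [EMetricSpace X] [MeasurableSpace X] [BorelSpace X]
    (g : ℝ≥0 → ℝ≥0) : Measure X :=
  Measure.mkMetric fun d : ℝ≥0∞ => if d = ∞ then ∞ else (g d.toNNReal : ℝ≥0∞)

/-- The lower scaled oscillation at `x` of the function `f` with domain `s`,
`l_f(x) = liminf_{r → 0+} (sup {|f y - f x| : y ∈ s, d(x, y) ≤ r}) / r`, with values in `[0,∞]`. -/
def lowerScaledOscillation {X Y : Type*} [PseudoMetricSpace X] [PseudoMetricSpace Y]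
    (f : X → Y) (s : Set X) (x : X) : ℝ≥0∞ :=
  liminf (fun r : ℝ => (⨆ y ∈ s ∩ Metric.closedBall x r, edist (f y) (f x)) / ENNReal.ofReal r)
    (𝓝[>] (0 : ℝ))

/-- The closed unit cube `[0,1]^n` in Euclidean space `ℝ^n`. -/
def unitCube (n : ℕ) : Set (EuclideanSpace ℝ (Fin n)) :=
  {x | ∀ i, x i ∈ Icc (0 : ℝ) 1}

end

open MeasureTheory Filter Topology Set
open scoped NNReal ENNReal

/-! Sum tents of height `e k / 2` and radius `e (k + 1)` around finite nets `S k` of spacing `e k /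
(2 * (k + 1))`, with `e (k + 1)` far smaller than `e k`. A point `x` lying near only finitely many
of the nets sees, at scale `e k`, a fixed Lipschitz sum plus a tail between `0` and `e k`, so the
oscillation is linear along the radii `e k`. Yet a net point within `e k / (2 * (k + 1))` of `x`
carries a tent of height `e k / 2`, so difference quotients are unbounded. The remaining points form
a limsup set of balls; as `e (k + 1)` is chosen after `S k`, their gauges and volumes are summable,
and Borel–Cantelli makes the set null for both measures. -/

section Spike

variable {X : Type*} [PseudoMetricSpace X]

/-- The tent function of height `h` and width `d` around the set `S`. -/
noncomputable def spike (S : Set X) (h d : ℝ) (x : X) : ℝ :=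
  h * max 0 (1 - Metric.infDist x S / d)

lemma spike_nonneg {S : Set X} {h d : ℝ} (hh : 0 ≤ h) (x : X) : 0 ≤ spike S h d x :=
  mul_nonneg hh (le_max_left _ _)

lemma spike_le {S : Set X} {h d : ℝ} (hh : 0 ≤ h) (hd : 0 ≤ d) (x : X) : spike S h d x ≤ h := by
  have h1 : 0 ≤ Metric.infDist x S / d := div_nonneg Metric.infDist_nonneg hd
  have h2 : max 0 (1 - Metric.infDist x S / d) ≤ 1 := max_le zero_le_one (by linarith)
  exact mul_le_of_le_one_right hh h2

lemma spike_of_mem {S : Set X} {h d : ℝ} {x : X} (hx : x ∈ S) : spike S h d x = h := by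
  simp [spike, Metric.infDist_zero_of_mem hx]

lemma spike_eq_zero {S : Set X} {h d : ℝ} (hd : 0 < d) {x : X} (hx : d ≤ Metric.infDist x S) :
    spike S h d x = 0 := by
  have h1 : 1 ≤ Metric.infDist x S / d := (one_le_div hd).2 hx
  rw [spike, max_eq_left (by linarith), mul_zero]

lemma abs_spike_sub_le {S : Set X} {h d : ℝ} (hh : 0 ≤ h) (hd : 0 < d) (x y : X) :
    |spike S h d x - spike S h d y| ≤ h / d * dist x y := by
  have h1 : |Metric.infDist x S - Metric.infDist y S| ≤ dist x y := by
    simpa [Real.dist_eq] using (Metric.lipschitz_infDist_pt S).dist_le_mul x y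
  have h2 := abs_max_sub_max_le_abs (1 - Metric.infDist x S / d) (1 - Metric.infDist y S / d) 0
  rw [spike, spike, ← mul_sub, abs_mul, abs_of_nonneg hh, div_mul_eq_mul_div, mul_div_assoc]
  refine mul_le_mul_of_nonneg_left ?_ hh
  rw [max_comm 0, max_comm 0]
  refine h2.trans ?_
  rw [show 1 - Metric.infDist x S / d - (1 - Metric.infDist y S / d)
    = -((Metric.infDist x S - Metric.infDist y S) / d) by ring, abs_neg, abs_div, abs_of_pos hd]
  gcongr

lemma continuous_spike (S : Set X) (h d : ℝ) : Continuous (spike S h d) :=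
  continuous_const.mul (continuous_const.max
    (continuous_const.sub ((Metric.continuous_infDist_pt S).div_const d)))

lemma exists_abs_sum_sub_le {F : ℕ → X → ℝ} (hF : ∀ k, ∃ C, ∀ x y, |F k x - F k y| ≤ C * dist x y)
    (s : Finset ℕ) :
    ∃ C, ∀ x y, |∑ k ∈ s, F k x - ∑ k ∈ s, F k y| ≤ C * dist x y := by
  choose C hC using hF
  refine ⟨∑ k ∈ s, C k, fun x y => ?_⟩
  rw [← Finset.sum_sub_distrib, Finset.sum_mul]
  exact (Finset.abs_sum_le_sum_abs _ _).trans (Finset.sum_le_sum fun k _ => hC k x y)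

lemma exists_finset_net {K : Set X} (hK : IsCompact K) {p : ℝ} (hp : 0 < p) :
    ∃ S : Finset X, ↑S ⊆ K ∧ ∀ x ∈ K, ∃ q ∈ S, dist q x ≤ p := by
  obtain ⟨t, htK, htf, hcov⟩ := hK.finite_cover_balls hp
  refine ⟨htf.toFinset, by simpa using htK, fun x hx => ?_⟩
  obtain ⟨q, hq, hxq⟩ := mem_iUnion₂.1 (hcov hx)
  exact ⟨q, htf.mem_toFinset.2 hq, (Metric.mem_ball'.1 hxq).le⟩

/-- Nets of a compact set at rapidly decreasing scales, with a weighted number of points that is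
summable. -/
lemma exists_nets {K : Set X} (hK : IsCompact K) {φ : ℝ → ℝ≥0∞}
    (hφ : Tendsto φ (𝓝[>] 0) (𝓝 0)) :
    ∃ (S : ℕ → Finset X) (e : ℕ → ℝ), e 0 = 1 ∧ (∀ k, 0 < e k) ∧ (∀ k, e (k + 1) ≤ e k / 2) ∧
      (∀ k, ↑(S k) ⊆ K) ∧ (∀ k, ∀ x ∈ K, ∃ q ∈ S k, dist q x ≤ e k / 2 / (k + 1)) ∧
      ∀ k, (S k).card * φ (e (k + 1)) ≤ (1 / 2) ^ k := by
  -- Positivity of `η` sits inside the existential so that `choose` returns functions of `k` and `η`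
  -- alone, which can be iterated.
  have step : ∀ (k : ℕ) (η : ℝ), ∃ (S : Finset X) (d : ℝ), 0 < η → 0 < d ∧ d ≤ η / 2 ∧ ↑S ⊆ K ∧
      (∀ x ∈ K, ∃ q ∈ S, dist q x ≤ η / 2 / (k + 1)) ∧ S.card * φ d ≤ (1 / 2) ^ k := by
    intro k η
    by_cases hη : 0 < η
    · obtain ⟨S, hSK, hS⟩ := exists_finset_net hK (p := η / 2 / (k + 1)) (by positivity)
      -- The net depends only on `η`, so its cardinality stays fixed while `d` shrinks.
      have h1 : Tendsto (fun d => S.card * φ d) (𝓝[>] 0) (𝓝 0) := by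
        simpa using ENNReal.Tendsto.const_mul hφ (Or.inr (ENNReal.natCast_ne_top S.card))
      have h2 : ∀ᶠ d in 𝓝[>] (0 : ℝ), S.card * φ d < (1 / 2) ^ k :=
        h1.eventually_lt_const (ENNReal.pow_pos (by simp) k)
      have h3 : ∀ᶠ d in 𝓝[>] (0 : ℝ), d ∈ Ioc 0 (η / 2) := Ioc_mem_nhdsGT (by positivity)
      obtain ⟨d, hd, hd'⟩ := (h2.and h3).exists
      exact ⟨S, d, fun _ => ⟨hd'.1, hd'.2, hSK, hS, hd.le⟩⟩
    · exact ⟨∅, 0, fun h => absurd h hη⟩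
  choose S D hSD using step
  let e : ℕ → ℝ := fun k => Nat.rec 1 (fun k η => D k η) k
  have he : ∀ k, 0 < e k := by
    intro k
    induction k with
    | zero => exact one_pos
    | succ k ih => exact (hSD k (e k) ih).1
  exact ⟨fun k => S k (e k), e, rfl, he, fun k => (hSD k _ (he k)).2.1,
    fun k => (hSD k _ (he k)).2.2.1, fun k => (hSD k _ (he k)).2.2.2.1,
    fun k => (hSD k _ (he k)).2.2.2.2⟩

/-- A continuous function that, at each point of `K` not too close to infinitely many of the sets
`S k`, has finite lower scaled oscillation and unbounded difference quotients. -/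
theorem exists_continuous_lowerScaledOscillation_lt_top {K : Set X} (hK : IsCompact K)
    {φ : ℝ → ℝ≥0∞} (hφ : Tendsto φ (𝓝[>] 0) (𝓝 0)) :
    ∃ (f : X → ℝ) (S : ℕ → Finset X) (d : ℕ → ℝ), Continuous f ∧ (∀ k, 0 < d k) ∧ Antitone d ∧
      Tendsto d atTop (𝓝 0) ∧ (∀ k, (S k).card * φ (d k) ≤ (1 / 2) ^ k) ∧
      ∀ x ∈ K, (∀ᶠ k in atTop, ∀ q ∈ S k, 2 * d k ≤ dist x q) →
        lowerScaledOscillation f K x < ∞ ∧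
        ∀ C : ℝ, ¬ ∀ᶠ y in 𝓝[K] x, |f y - f x| ≤ C * dist y x := by
  obtain ⟨S, e, he0, hepos, hehalf, hSK, hnet, hcard⟩ := exists_nets hK hφ
  have he : ∀ m k, e (m + k) ≤ e m / 2 ^ k := by
    intro m k
    induction k with
    | zero => simp
    | succ k ih =>
      calc e (m + (k + 1)) ≤ e (m + k) / 2 := hehalf _
        _ ≤ e m / 2 ^ k / 2 := by gcongr
        _ = e m / 2 ^ (k + 1) := by rw [pow_succ, div_div]
  have hanti : Antitone e := antitone_nat_of_succ_le fun k => by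
    linarith [hehalf k, hepos k]
  have helim : Tendsto e atTop (𝓝 0) := by
    refine squeeze_zero (fun k => (hepos k).le) (g := fun k : ℕ => (1 / 2 : ℝ) ^ k) (fun k => ?_)
      (tendsto_pow_atTop_nhds_zero_of_lt_one (by norm_num) (by norm_num))
    simpa [he0] using he 0 k
  let F : ℕ → X → ℝ := fun k => spike (S k : Set X) (e k / 2) (e (k + 1))
  have hF0 : ∀ k x, 0 ≤ F k x := fun k x => spike_nonneg (by linarith [hepos k]) x
  have hFle : ∀ k x, F k x ≤ e k / 2 := fun k x =>
    spike_le (by linarith [hepos k]) (hepos _).le x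
  have hFle' : ∀ m k x, F (k + m) x ≤ e m / 2 / 2 ^ k := fun m k x => by
    have h1 := he m k
    rw [add_comm m k] at h1
    calc F (k + m) x ≤ e (k + m) / 2 := hFle _ _
      _ ≤ e m / 2 ^ k / 2 := by gcongr
      _ = e m / 2 / 2 ^ k := by ring
  have hgeo : ∀ m, HasSum (fun k : ℕ => e m / 2 / 2 ^ k) (e m) := fun m =>
    hasSum_geometric_two' (e m)
  have hsumm : ∀ m x, Summable fun k => F (k + m) x := fun m x =>
    Summable.of_nonneg_of_le (fun k => hF0 _ _) (fun k => hFle' m k x) (hgeo m).summable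
  have htail0 : ∀ m x, 0 ≤ ∑' k, F (k + m) x := fun m x => tsum_nonneg fun k => hF0 _ _
  have htail : ∀ m x, ∑' k, F (k + m) x ≤ e m := fun m x =>
    hasSum_le (fun k => hFle' m k x) (hsumm m x).hasSum (hgeo m)
  let f : X → ℝ := fun x => ∑' k, F k x
  have hf : ∀ m x, f x = ∑ k ∈ Finset.range m, F k x + ∑' k, F (k + m) x := fun m x =>
    ((hsumm 0 x).sum_add_tsum_nat_add m).symm
  have hfcont : Continuous f := by
    refine continuous_tsum (fun k => continuous_spike _ _ _) (hgeo 0).summable fun k x => ?_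
    rw [Real.norm_of_nonneg (hF0 k x)]
    exact hFle' 0 k x
  refine ⟨f, S, fun k => e (k + 1), hfcont, fun k => hepos _,
    fun _ _ hij => hanti (Nat.succ_le_succ hij), (tendsto_add_atTop_iff_nat 1).2 helim,
    hcard, fun x hxK hx => ?_⟩
  obtain ⟨m, hm⟩ := eventually_atTop.1 hx
  have hSne : ∀ k, (S k : Set X).Nonempty := fun k =>
    let ⟨q, hq, _⟩ := hnet k x hxK
    ⟨q, hq⟩
  -- Separation by twice the tent radius leaves a whole ball around `x` free of tents, not just `x`
  -- itself.
  have hFnear : ∀ k ≥ m, ∀ y, dist y x ≤ e (k + 1) → F k y = 0 := by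
    intro k hk y hy
    refine spike_eq_zero (hepos _) ((Metric.le_infDist (hSne k)).2 fun q hq => ?_)
    have h1 := hm k hk q hq
    have h2 := dist_triangle_left x q y
    linarith
  -- For `m ≤ j < k`, the tent-free radius `e (j + 1)` is at least `e k`.
  have hsum_near : ∀ k ≥ m, ∀ y, dist y x ≤ e k →
      ∑ j ∈ Finset.range k, F j y = ∑ j ∈ Finset.range m, F j y := by
    intro k hk y hy
    refine (Finset.sum_subset (Finset.range_subset_range.2 hk) fun j hj hj' => ?_).symm
    rw [Finset.mem_range] at hj hj'
    exact hFnear j (not_lt.1 hj') y (hy.trans (hanti hj))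
  have hfx : f x = ∑ j ∈ Finset.range m, F j x := by
    have h1 : ∀ k, F (k + m) x = 0 := fun k =>
      hFnear _ (Nat.le_add_left _ _) x (by simpa using (hepos _).le)
    rw [hf m x]
    simp [h1]
  obtain ⟨C, hC⟩ := exists_abs_sum_sub_le (F := F)
    (fun k => ⟨_, abs_spike_sub_le (by linarith [hepos k]) (hepos _)⟩) (Finset.range m)
  constructor
  -- A liminf needs a bound only along the radii `e k`.
  · have hlim : Tendsto e atTop (𝓝[>] 0) :=
      tendsto_nhdsWithin_iff.2 ⟨helim, Eventually.of_forall hepos⟩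
    have hfreq : ∃ᶠ r in 𝓝[>] (0 : ℝ),
        (⨆ y ∈ K ∩ Metric.closedBall x r, edist (f y) (f x)) / ENNReal.ofReal r
          ≤ ENNReal.ofReal (|C| + 1) := by
      refine hlim.frequently (Eventually.frequently ?_)
      filter_upwards [eventually_ge_atTop m] with k hk
      refine ENNReal.div_le_of_le_mul (iSup₂_le fun y hy => ?_)
      have hy' : dist y x ≤ e k := hy.2
      have hfy : f y = ∑ j ∈ Finset.range m, F j y + ∑' j, F (j + k) y := by
        rw [hf k y, hsum_near k hk y hy']
      have h1 := abs_le.1 (hC y x)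
      have h2 := htail0 k y
      have h3 := htail k y
      have h4 : |f y - f x| ≤ (|C| + 1) * e k := by
        have h5 : C * dist y x ≤ |C| * e k :=
          mul_le_mul (le_abs_self C) hy' dist_nonneg (abs_nonneg C)
        have := hepos k
        rw [abs_le, hfy, hfx, add_mul, one_mul]
        constructor <;> linarith
      rw [edist_dist, Real.dist_eq, ← ENNReal.ofReal_mul (by positivity)]
      exact ENNReal.ofReal_le_ofReal h4
    exact (liminf_le_of_frequently_le' hfreq).trans_lt ENNReal.ofReal_lt_top
  · intro C' hC'
    let p : ℕ → ℝ := fun k => e k / 2 / (k + 1)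
    have hp : ∀ k, 0 < p k := fun k => by have := hepos k; positivity
    have hple : ∀ k, p k ≤ e k := fun k => by
      have h1 : e k / 2 / (k + 1) ≤ e k / 2 :=
        div_le_self (by linarith [hepos k]) (by linarith [Nat.cast_nonneg (α := ℝ) k])
      linarith [hepos k]
    choose q hqS hq using fun k => hnet k x hxK
    have hqlim : Tendsto q atTop (𝓝[K] x) := by
      refine tendsto_nhdsWithin_iff.2 ⟨?_, Eventually.of_forall fun k => hSK k (hqS k)⟩
      exact tendsto_iff_dist_tendsto_zero.2
        (squeeze_zero (fun _ => dist_nonneg) (fun k => (hq k).trans (hple k)) helim)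
    -- The ratio of tent height to net spacing is `k + 1`; it must beat the Lipschitz constant of
    -- the first `m` tents plus the supposed bound.
    obtain ⟨k, hk1, hk2, hk3⟩ := ((hqlim.eventually hC').and ((eventually_ge_atTop m).and
      (tendsto_natCast_atTop_atTop.eventually_ge_atTop (|C| + |C'|)))).exists
    have h1 : F k (q k) = e k / 2 := spike_of_mem (hqS k)
    have h2 : ∑ j ∈ Finset.range m, F j (q k) + e k / 2 ≤ f (q k) := by
      have h3 := htail0 (k + 1) (q k)
      have h4 := hf (k + 1) (q k)
      rw [Finset.sum_range_succ, h1] at h4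
      have h5 : ∑ j ∈ Finset.range m, F j (q k) ≤ ∑ j ∈ Finset.range k, F j (q k) :=
        Finset.sum_le_sum_of_subset_of_nonneg (Finset.range_subset_range.2 hk2)
          fun j _ _ => hF0 j _
      linarith
    have h3 := abs_le.1 (hC (q k) x)
    have h4 := abs_le.1 hk1
    have h5 : ∀ c : ℝ, c * dist (q k) x ≤ |c| * p k := fun c =>
      mul_le_mul (le_abs_self c) (hq k) dist_nonneg (abs_nonneg c)
    have h6 : e k / 2 = (k + 1) * p k := by
      simp only [p]
      field_simp
    have h7 : (|C| + |C'|) * p k < (k + 1) * p k := by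
      exact mul_lt_mul_of_pos_right (by linarith) (hp k)
    have h8 := h5 C
    have h9 := h5 C'
    linarith [h3.1, h4.2]

end Spike

/-! ### Null exceptional sets and the unit cube -/

lemma isCompact_unitCube (n : ℕ) : IsCompact (unitCube n) := by
  have h : unitCube n = (EuclideanSpace.equiv (Fin n) ℝ).symm ''
      (Set.pi univ fun _ : Fin n => Icc (0 : ℝ) 1) := by
    ext x
    constructor
    · intro hx
      exact ⟨_, fun i _ => hx i, (EuclideanSpace.equiv (Fin n) ℝ).symm_apply_apply x⟩
    · rintro ⟨y, hy, rfl⟩ i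
      exact hy i trivial
  rw [h]
  exact (isCompact_univ_pi fun _ => isCompact_Icc).image
    (EuclideanSpace.equiv (Fin n) ℝ).symm.continuous

/-- The Hausdorff measure of a limsup set of balls whose gauges are summable vanishes. -/
lemma gaugeHausdorffMeasure_eq_zero {X : Type*} [MetricSpace X] [MeasurableSpace X] [BorelSpace X]
    {g : ℝ≥0 → ℝ≥0} (hg : Monotone g) {S : ℕ → Finset X} {r : ℕ → ℝ} (hanti : Antitone r)
    (hr : Tendsto r atTop (𝓝 0))
    (hsum : ∑' k, ((S k).card : ℝ≥0∞) * g (2 * (r k).toNNReal) ≠ ∞) {E : Set X}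
    (hE : ∀ x ∈ E, ∃ᶠ k in atTop, ∃ q ∈ S k, dist x q < r k) :
    gaugeHausdorffMeasure g E = 0 := by
  have hdiam : ∀ k (q : X), Metric.ediam (Metric.ball q (r k)) ≤ 2 * ENNReal.ofReal (r k) := by
    intro k q
    rw [← Metric.eball_ofReal]
    exact Metric.ediam_eball_le
  have hgauge : ∀ k (q : X), (if Metric.ediam (Metric.ball q (r k)) = ∞ then ∞ else
      (g (Metric.ediam (Metric.ball q (r k))).toNNReal : ℝ≥0∞)) ≤ g (2 * (r k).toNNReal) := by
    intro k q
    have h1 : Metric.ediam (Metric.ball q (r k)) ≤ ((2 * (r k).toNNReal : ℝ≥0) : ℝ≥0∞) := by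
      simpa [ENNReal.ofReal] using hdiam k q
    rw [if_neg (ne_top_of_le_ne_top ENNReal.coe_ne_top h1)]
    exact ENNReal.coe_le_coe.2 (hg (ENNReal.toNNReal_mono ENNReal.coe_ne_top h1))
  have hlim : Tendsto (fun k => 2 * ENNReal.ofReal (r k)) atTop (𝓝 0) := by
    have h1 := ENNReal.Tendsto.const_mul (a := 2) (ENNReal.tendsto_ofReal hr) (Or.inr (by simp))
    simpa using h1
  -- For every `N`, the balls of index at least `N` cover `E`, and their cost is a tail of a
  -- convergent series.
  refine le_antisymm ((Measure.mkMetric_le_liminf_tsum (ι := fun N => Σ k, S (k + N)) E _ hlim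
    (fun N i => Metric.ball (i.2 : X) (r (i.1 + N))) (Eventually.of_forall fun N i => ?_)
    (Eventually.of_forall fun N x hx => ?_) _).trans ?_) zero_le
  · refine (hdiam _ _).trans ?_
    gcongr
    exact hanti (Nat.le_add_left _ _)
  · obtain ⟨k, hk, q, hq, hxq⟩ := frequently_atTop.1 (hE x hx) N
    obtain ⟨j, rfl⟩ := Nat.exists_eq_add_of_le' hk
    exact mem_iUnion.2 ⟨⟨j, q, hq⟩, hxq⟩
  · refine le_of_le_of_eq (liminf_le_liminf (Eventually.of_forall fun N => ?_))
      (ENNReal.tendsto_sum_nat_add _ hsum).liminf_eq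
    rw [ENNReal.tsum_sigma']
    refine ENNReal.tsum_le_tsum fun k => ?_
    rw [tsum_fintype]
    refine (Finset.sum_le_card_nsmul (Finset.univ : Finset (S (k + N))) _ _ fun q _ => hgauge (k + N) q.1).trans_eq ?_
    simp

theorem theorem1p2 (n : ℕ) (hn : 1 ≤ n) (g : ℝ≥0 → ℝ≥0) (hg : IsGaugeFunction g) :
    ∃ f : EuclideanSpace ℝ (Fin n) → ℝ,
      ContinuousOn f (unitCube n) ∧
      (∀ᵐ x ∂(volume.restrict (unitCube n)), ¬ DifferentiableWithinAt ℝ f (unitCube n) x) ∧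
      ∃ E : Set (EuclideanSpace ℝ (Fin n)), E ⊆ unitCube n ∧
        gaugeHausdorffMeasure g E = 0 ∧
        ∀ x ∈ unitCube n \ E, lowerScaledOscillation f (unitCube n) x < ∞ := by
  have : Nonempty (Fin n) := ⟨⟨0, hn⟩⟩
  -- Balls of radius `2 * d` have diameter at most `4 * d`. Running the construction with `γ + ν`
  -- controls gauge and volume at once.
  let γ : ℝ → ℝ≥0∞ := fun d => g (2 * (2 * d).toNNReal)
  let ν : ℝ → ℝ≥0∞ := fun d => volume (Metric.ball (0 : EuclideanSpace ℝ (Fin n)) (2 * d))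
  have hγ : Tendsto γ (𝓝[>] 0) (𝓝 0) := by
    have h1 : Continuous γ := ENNReal.continuous_coe.comp (hg.continuous.comp
      (continuous_const.mul (continuous_real_toNNReal.comp (continuous_const.mul continuous_id))))
    simpa [γ, hg.map_zero] using (h1.tendsto 0).mono_left nhdsWithin_le_nhds
  have hν : Tendsto ν (𝓝[>] 0) (𝓝 0) := by
    have h1 : Continuous fun d : ℝ => ENNReal.ofReal ((2 * d) ^ n) :=
      ENNReal.continuous_ofReal.comp (by fun_prop)
    have h2 : Tendsto (fun d : ℝ => ENNReal.ofReal ((2 * d) ^ n) *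
        volume (Metric.ball (0 : EuclideanSpace ℝ (Fin n)) 1)) (𝓝[>] 0) (𝓝 0) := by
      have h3 := ENNReal.Tendsto.mul_const ((h1.tendsto 0).mono_left (nhdsWithin_le_nhds (s := Ioi 0)))
        (Or.inr (measure_ball_lt_top (μ := volume)
          (x := (0 : EuclideanSpace ℝ (Fin n))) (r := 1)).ne)
      simpa [zero_pow (by omega : n ≠ 0)] using h3
    refine h2.congr' ?_
    filter_upwards [self_mem_nhdsWithin] with d hd
    have hd' : (0 : ℝ) < d := hd
    simp only [ν]
    rw [Measure.addHaar_ball _ _ (by positivity : 0 ≤ 2 * d), finrank_euclideanSpace_fin]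
  obtain ⟨f, S, d, hf, hd, hanti, hlim, hcard, hfx⟩ :=
    exists_continuous_lowerScaledOscillation_lt_top (isCompact_unitCube n)
      (φ := fun t => γ t + ν t) (by simpa using hγ.add hν)
  have hsum : ∀ ψ : ℝ → ℝ≥0∞, (∀ t, ψ t ≤ γ t + ν t) → ∑' k, (S k).card * ψ (d k) ≠ ∞ := by
    intro ψ hψ
    have h1 : ∑' k : ℕ, (1 / 2 : ℝ≥0∞) ^ k ≠ ∞ := by
      simp [ENNReal.tsum_geometric]
    exact ne_top_of_le_ne_top h1 (ENNReal.tsum_le_tsum fun k =>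
      (mul_le_mul_right (hψ _) _).trans (hcard k))
  have hdiff : ∀ x ∈ unitCube n, (∀ᶠ k in atTop, ∀ q ∈ S k, 2 * d k ≤ dist x q) →
      ¬ DifferentiableWithinAt ℝ f (unitCube n) x := by
    intro x hx hxS hdf
    obtain ⟨C, hC⟩ := hdf.isBigO_sub.bound
    refine (hfx x hx hxS).2 C ?_
    simpa [dist_eq_norm] using hC
  refine ⟨f, hf.continuousOn, ?_,
    {x ∈ unitCube n | ∃ᶠ k in atTop, ∃ q ∈ S k, dist x q < 2 * d k}, sep_subset _ _, ?_, ?_⟩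
  · have h1 : volume (limsup (fun k => ⋃ q ∈ S k, Metric.ball q (2 * d k)) atTop) = 0 := by
      refine measure_limsup_atTop_eq_zero (ne_top_of_le_ne_top (hsum ν fun t => le_add_self)
        (ENNReal.tsum_le_tsum fun k => (measure_biUnion_finset_le _ _).trans_eq ?_))
      simp [ν, Measure.addHaar_ball_center]
    rw [ae_restrict_iff' (isCompact_unitCube n).measurableSet]
    filter_upwards [compl_mem_ae_iff.2 h1] with x hxS hx
    refine hdiff x hx ?_
    rw [mem_compl_iff, mem_limsup_iff_frequently_mem, not_frequently] at hxS
    filter_upwards [hxS] with k hk q hq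
    by_contra! hlt
    exact hk (mem_iUnion₂.2 ⟨q, hq, hlt⟩)
  · exact gaugeHausdorffMeasure_eq_zero hg.monotone (r := fun k => 2 * d k)
      (fun i j hij => by have := hanti hij; dsimp only; linarith)
      (by simpa using hlim.const_mul 2) (hsum γ fun t => le_self_add) fun x hx => hx.2
  · intro x hx
    refine (hfx x hx.1 ?_).1
    by_contra h
    refine hx.2 ⟨hx.1, ?_⟩
    rw [not_eventually] at h
    exact h.mono fun k hk => by simpa using hk
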